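/- Let $m,n\ge 1$ be integers, let $\pi$ be a probability distribution on the set of intents $[m]$, and let $[n]$ be the set of queries. Use the reward $r_{i\ell}=1$ if $i=\ell$ and $r_{i\ell}=0$ otherwise ($i,\ell\in[m]$), and the expected payoff $$u_r(U,D)=\sum_{i=1}^m\pi_i\sum_{j=1}^nU_{ij}\sum_{\ell=1}^mD_{j\ell}\,r_{i\ell}.$$ Let $S(0)\in\mathbb R^{m\times n}$ and $R(0)\in\mathbb R^{n\times m}$ have strictly positive entries, and let $0\le t_1<t_2<\cdots$ be a fixed infinite sequence of integers (the rounds in which the user adapts). At every time $t\ge 0$ the user's and the DBMS's strategies are $$U_{ij}(t)=\frac{S_{ij}(t)}{\sum_{j'=1}^nS_{ij'}(t)},\qquad D_{j\ell}(t)=\frac{R_{j\ell}(t)}{\sum_{\ell'=1}^mR_{j\ell'}(t)}.$$ In round $t=0,1,2,\dots$, given the history of all earlier rounds, an intent $i(t)=i$ is drawn with probability $\pi_i$ (independently of the history), then a query $q(t)=j$ is drawn with probability $U_{ij}(t)$, and then the DBMS interprets the query as the intent $i'(t)=\ell$ with probability $D_{j\ell}(t)$. That is, the conditional probability of $(i(t),q(t),i'(t))=(i,j,\ell)$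 given the history is $\pi_iU_{ij}(t)D_{j\ell}(t)$. The reward matrices are then updated as follows. * If $t\notin\{t_1,t_2,\dots\}$, only the DBMS adapts: the entry $R_{q(t)\,i'(t)}$ is increased by $r_{i(t)\,i'(t)}$, and all other entries of $R$ and all entries of $S$ are unchanged. * If $t\in\{t_1,t_2,\dots\}$, only the user adapts: the entry $S_{i(t)\,q(t)}$ is increased by $r_{i(t)\,i'(t)}$, and all other entries of $S$ and all entries of $R$ are unchanged. Then the payoff sequence $u(t)=u_r(U(t),D(t))$, $t=0,1,2,\dots$, converges almost surely (to a finite limit). -/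

import Mathlib

open MeasureTheory Filter Topology

noncomputable section

namespace DataInteraction

/-- One interaction: the user's intent (an element of `[m]`), the query she submits (an element of
`[n]`), and the intent (result) by which the DBMS interprets the query (an element of `[o]`). -/
abbrev Interaction (m n o : ℕ) : Type := Fin m × Fin n × Fin o

/-- The strategy induced by a matrix of accumulated rewards: each row divided by its sum. -/
def strategyOf {a b : ℕ} (W : Matrix (Fin a) (Fin b) ℝ) : Matrix (Fin a) (Fin b) ℝ :=
  Matrix.of fun x y => W x y / ∑ y', W x y'

/-- The expected payoff `u_r(U, D) = ∑ i, π i * ∑ j, U i j * ∑ ℓ, D j ℓ * r i ℓ`. -/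
def payoff {m n o : ℕ} (prior : Fin m → ℝ) (r : Matrix (Fin m) (Fin o) ℝ)
    (U : Matrix (Fin m) (Fin n) ℝ) (D : Matrix (Fin n) (Fin o) ℝ) : ℝ :=
  ∑ i, prior i * ∑ j, U i j * ∑ l, D j l * r i l

/-- The 0/1 identity similarity measure: reward 1 if the interpreted intent is the actual intent,
and reward 0 otherwise. -/
def identityReward (m : ℕ) : Matrix (Fin m) (Fin m) ℝ :=
  Matrix.of fun i l => if i = l then 1 else 0

section Dynamics

variable {m n o : ℕ}

open Classical in
/-- The accumulated rewards `R(t)` of the DBMS along the sequence `x` of interactions, started from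
`R0`. In every round that is not a user-adaptation round, the entry (query, result) of the round is
increased by the reward of the round; in a user-adaptation round nothing changes. -/
def dbmsRewards (r : Matrix (Fin m) (Fin o) ℝ) (userTimes : Set ℕ)
    (R0 : Matrix (Fin n) (Fin o) ℝ) (x : ℕ → Interaction m n o) :
    ℕ → Matrix (Fin n) (Fin o) ℝ
  | 0 => R0
  | t + 1 => Matrix.of fun j l =>
      if t ∉ userTimes ∧ j = (x t).2.1 ∧ l = (x t).2.2 then
        dbmsRewards r userTimes R0 x t j l + r (x t).1 l
      else dbmsRewards r userTimes R0 x t j l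

open Classical in
/-- The accumulated rewards `S(t)` of the user along the sequence `x` of interactions, started from
`S0`. In every user-adaptation round, the entry (intent, query) of the round is increased by the
reward of the round; in all other rounds nothing changes. -/
def userRewards (r : Matrix (Fin m) (Fin o) ℝ) (userTimes : Set ℕ)
    (S0 : Matrix (Fin m) (Fin n) ℝ) (x : ℕ → Interaction m n o) :
    ℕ → Matrix (Fin m) (Fin n) ℝ
  | 0 => S0
  | t + 1 => Matrix.of fun i j =>
      if t ∈ userTimes ∧ i = (x t).1 ∧ j = (x t).2.1 then
        userRewards r userTimes S0 x t i j + r i (x t).2.2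
      else userRewards r userTimes S0 x t i j

/-- The DBMS strategy `D(t)`. -/
def dbmsStrategy (r : Matrix (Fin m) (Fin o) ℝ) (userTimes : Set ℕ)
    (R0 : Matrix (Fin n) (Fin o) ℝ) (x : ℕ → Interaction m n o) (t : ℕ) :
    Matrix (Fin n) (Fin o) ℝ :=
  strategyOf (dbmsRewards r userTimes R0 x t)

/-- The user strategy `U(t)`. -/
def userStrategy (r : Matrix (Fin m) (Fin o) ℝ) (userTimes : Set ℕ)
    (S0 : Matrix (Fin m) (Fin n) ℝ) (x : ℕ → Interaction m n o) (t : ℕ) :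
    Matrix (Fin m) (Fin n) ℝ :=
  strategyOf (userRewards r userTimes S0 x t)

/-- The payoff `u(t) = u_r(U(t), D(t))`. -/
def payoffAt (prior : Fin m → ℝ) (r : Matrix (Fin m) (Fin o) ℝ) (userTimes : Set ℕ)
    (S0 : Matrix (Fin m) (Fin n) ℝ) (R0 : Matrix (Fin n) (Fin o) ℝ)
    (x : ℕ → Interaction m n o) (t : ℕ) : ℝ :=
  payoff prior r (userStrategy r userTimes S0 x t) (dbmsStrategy r userTimes R0 x t)

variable {Ω : Type*}

/-- The history before round `t`: the σ-algebra generated by the interactions of the rounds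
`0, …, t - 1`. -/
abbrev past (X : ℕ → Ω → Interaction m n o) (t : ℕ) : MeasurableSpace Ω :=
  ⨆ s : ℕ, ⨆ _ : s < t, MeasurableSpace.comap (X s) inferInstance

/-- The random sequence of interactions `X` is generated by the joint learning dynamics. In each
round `t`, given the history, the intent is drawn from `prior` (whatever the history is); given also
the intent `i`, the query is drawn from row `i` of `U(t)`; given also the query `j`, the
interpretation is drawn from row `j` of `D(t)`. By the chain rule this says that, given the
history, the triple `(i, j, l)` has conditional probability `prior i * U(t) i j * D(t) j l`. -/
structure IsJointLearning [MeasurableSpace Ω] (μ : Measure Ω) (prior : Fin m → ℝ)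
    (r : Matrix (Fin m) (Fin o) ℝ) (userTimes : Set ℕ)
    (S0 : Matrix (Fin m) (Fin n) ℝ) (R0 : Matrix (Fin n) (Fin o) ℝ)
    (X : ℕ → Ω → Interaction m n o) : Prop where
  measurable : ∀ t, Measurable (X t)
  condProb : ∀ (t : ℕ) (i : Fin m) (j : Fin n) (l : Fin o),
    μ[(X t ⁻¹' {(i, j, l)}).indicator (fun _ => (1 : ℝ)) | past X t] =ᵐ[μ] fun ω =>
      prior i * userStrategy r userTimes S0 (fun s => X s ω) t i j *
        dbmsStrategy r userTimes R0 (fun s => X s ω) t j l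

end Dynamics

end DataInteraction

end

/-!
The payoff process is a bounded submartingale for the filtration of past interactions, so it
converges almost surely by Doob's theorem.

With the identity reward the payoff is `∑ i, ∑ j, prior i * U i j * D j i`. In every round exactly
one of the two matrices adapts, so the payoff is a linear functional `∑ x, ∑ y, c x y * P x y` of
the strategy `P` of the adapting matrix `W`, whose coefficients `c` (the prior times the other
strategy) stay fixed during the round. The rewarded entry is `(x, y)` with conditional probability
`c x y * P x y`, and rewarding it moves row `x` of `P` towards `y` by the factor
`1 / (∑ y', W x y' + 1)`, the same factor for all `y`. Hence the conditional drift
contributed by row `x` is that factor times `∑ y, P x y * (c x y) ^ 2 - (∑ y, P x y * c x y) ^ 2`,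
a variance, and so it is nonnegative (`reinforcement_drift_nonneg`). There is no error term: the
submartingale inequality is exact in the user rounds as well as in the DBMS rounds
(`payoff_drift_nonneg`).
-/

open DataInteraction

/-! ### Reinforcing one entry of a matrix of accumulated rewards -/

lemma strategyOf_nonneg {a b : ℕ} {W : Matrix (Fin a) (Fin b) ℝ} (hW : ∀ x y, 0 < W x y)
    (x : Fin a) (y : Fin b) : 0 ≤ strategyOf W x y :=
  div_nonneg (hW x y).le (Finset.sum_nonneg fun y' _ => (hW x y').le)

lemma sum_strategyOf {a b : ℕ} {W : Matrix (Fin a) (Fin b) ℝ} (hW : ∀ x y, 0 < W x y)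
    (x : Fin a) (y : Fin b) : ∑ y', strategyOf W x y' = 1 := by
  have hpos : 0 < ∑ y', W x y' :=
    Finset.sum_pos (fun y' _ => hW x y') ⟨y, Finset.mem_univ y⟩
  simp only [strategyOf, Matrix.of_apply, ← Finset.sum_div]
  exact div_self hpos.ne'

lemma strategyOf_le_one {a b : ℕ} {W : Matrix (Fin a) (Fin b) ℝ} (hW : ∀ x y, 0 < W x y)
    (x : Fin a) (y : Fin b) : strategyOf W x y ≤ 1 := by
  rw [← sum_strategyOf hW x y]
  exact Finset.single_le_sum (fun y' _ => strategyOf_nonneg hW x y') (Finset.mem_univ y)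

/-- Rewarding the entry `(x, y)` by `1` moves row `x` of the strategy towards the point mass at `y`
and leaves the other rows alone. -/
lemma strategyOf_add_single_sub {a b : ℕ} {W : Matrix (Fin a) (Fin b) ℝ}
    (hW : ∀ x y, 0 < W x y) (x x' : Fin a) (y y' : Fin b) :
    strategyOf (W + Matrix.single x y 1) x' y' - strategyOf W x' y' =
      if x = x' then ((if y = y' then 1 else 0) - strategyOf W x y') / (∑ z, W x z + 1)
      else 0 := by
  have hpos : 0 < ∑ z, W x z :=
    Finset.sum_pos (fun z _ => hW x z) ⟨y, Finset.mem_univ y⟩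
  by_cases hx : x = x'
  · subst hx
    simp only [strategyOf, Matrix.of_apply, Matrix.add_apply, Matrix.single_apply, true_and,
      Finset.sum_add_distrib, Finset.sum_ite_eq, Finset.mem_univ, if_true]
    field_simp
    ring
  · simp [strategyOf, Matrix.single_apply, hx]

lemma linear_add_single_sub {a b : ℕ} {W : Matrix (Fin a) (Fin b) ℝ}
    (hW : ∀ x y, 0 < W x y) (c : Fin a → Fin b → ℝ) (x : Fin a) (y : Fin b) :
    ∑ x', ∑ y', c x' y' * strategyOf (W + Matrix.single x y 1) x' y' -
        ∑ x', ∑ y', c x' y' * strategyOf W x' y' =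
      (c x y - ∑ y', c x y' * strategyOf W x y') / (∑ z, W x z + 1) := by
  simp only [← Finset.sum_sub_distrib, ← mul_sub, strategyOf_add_single_sub hW, mul_ite, mul_zero]
  rw [Finset.sum_eq_single x (by simp +contextual [eq_comm]) (by simp)]
  simp only [if_true, ← mul_div_assoc, ← Finset.sum_div, mul_sub, Finset.sum_sub_distrib, mul_ite,
    mul_one, mul_zero, Finset.sum_ite_eq, Finset.mem_univ]

lemma variance_nonneg {b : ℕ} (p c : Fin b → ℝ) (hp : ∀ y, 0 ≤ p y) (hsum : ∑ y, p y = 1) :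
    0 ≤ ∑ y, c y * p y * (c y - ∑ z, c z * p z) := by
  set e := ∑ z, c z * p z with he
  have h : ∑ y, c y * p y * (c y - e) = ∑ y, p y * (c y - e) ^ 2 := by
    have h0 : ∑ y, e * (p y * (c y - e)) = 0 := by
      simp only [← Finset.mul_sum, mul_sub, Finset.sum_sub_distrib, ← Finset.sum_mul, hsum]
      simp [he, mul_comm]
    rw [← sub_eq_zero, ← Finset.sum_sub_distrib, ← h0]
    exact Finset.sum_congr rfl fun y _ => by ring
  rw [h]
  exact Finset.sum_nonneg fun y _ => mul_nonneg (hp y) (sq_nonneg _)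

/-- If a linear payoff of a strategy rewards each entry with probability equal to that entry's
contribution to the payoff, the payoff does not decrease on average. -/
lemma reinforcement_drift_nonneg {a b : ℕ} {W : Matrix (Fin a) (Fin b) ℝ}
    (hW : ∀ x y, 0 < W x y) (c : Fin a → Fin b → ℝ) :
    0 ≤ ∑ x, ∑ y, c x y * strategyOf W x y *
      (∑ x', ∑ y', c x' y' * strategyOf (W + Matrix.single x y 1) x' y' -
        ∑ x', ∑ y', c x' y' * strategyOf W x' y') := by
  simp only [linear_add_single_sub hW, ← mul_div_assoc, ← Finset.sum_div]
  refine Finset.sum_nonneg fun x _ => div_nonneg ?_ ?_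
  · rcases isEmpty_or_nonempty (Fin b) with hb | ⟨⟨y⟩⟩
    · simp
    · exact variance_nonneg _ _ (strategyOf_nonneg hW x) (sum_strategyOf hW x y)
  · exact add_nonneg (Finset.sum_nonneg fun z _ => (hW x z).le) zero_le_one

/-! ### One round of the joint learning dynamics -/

lemma identityReward_nonneg {m : ℕ} (i l : Fin m) : 0 ≤ identityReward m i l := by
  simp only [identityReward, Matrix.of_apply]
  split_ifs <;> norm_num

section Round

variable {m n o : ℕ} {r : Matrix (Fin m) (Fin o) ℝ} {T : Set ℕ}
  {S0 : Matrix (Fin m) (Fin n) ℝ} {R0 : Matrix (Fin n) (Fin o) ℝ}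
  {x y : ℕ → Interaction m n o} {t : ℕ}

lemma dbmsRewards_succ_of_mem (ht : t ∈ T) :
    dbmsRewards r T R0 x (t + 1) = dbmsRewards r T R0 x t := by
  ext; simp [dbmsRewards, ht]

lemma dbmsRewards_succ_of_notMem (ht : t ∉ T) :
    dbmsRewards r T R0 x (t + 1) = dbmsRewards r T R0 x t +
      Matrix.single (x t).2.1 (x t).2.2 (r (x t).1 (x t).2.2) := by
  ext j l
  simp only [dbmsRewards, ht, not_false_eq_true, true_and, Matrix.of_apply, Matrix.add_apply,
    Matrix.single_apply, @eq_comm _ j, @eq_comm _ l]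
  split_ifs with h
  · rw [h.2]
  · rw [add_zero]

lemma userRewards_succ_of_notMem (ht : t ∉ T) :
    userRewards r T S0 x (t + 1) = userRewards r T S0 x t := by
  ext; simp [userRewards, ht]

lemma userRewards_succ_of_mem (ht : t ∈ T) :
    userRewards r T S0 x (t + 1) = userRewards r T S0 x t +
      Matrix.single (x t).1 (x t).2.1 (r (x t).1 (x t).2.2) := by
  ext i j
  simp only [userRewards, ht, true_and, Matrix.of_apply, Matrix.add_apply,
    Matrix.single_apply, @eq_comm _ i, @eq_comm _ j]
  split_ifs with h
  · rw [h.1]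
  · rw [add_zero]

lemma dbmsRewards_pos (hr : ∀ i l, 0 ≤ r i l) (hR0 : ∀ j l, 0 < R0 j l) (j : Fin n) (l : Fin o) :
    0 < dbmsRewards r T R0 x t j l := by
  induction t with
  | zero => exact hR0 j l
  | succ t ih =>
    simp only [dbmsRewards, Matrix.of_apply]
    split_ifs
    · exact add_pos_of_pos_of_nonneg ih (hr _ _)
    · exact ih

lemma userRewards_pos (hr : ∀ i l, 0 ≤ r i l) (hS0 : ∀ i j, 0 < S0 i j) (i : Fin m) (j : Fin n) :
    0 < userRewards r T S0 x t i j := by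
  induction t with
  | zero => exact hS0 i j
  | succ t ih =>
    simp only [userRewards, Matrix.of_apply]
    split_ifs
    · exact add_pos_of_pos_of_nonneg ih (hr _ _)
    · exact ih

lemma dbmsRewards_congr (h : ∀ s < t, x s = y s) :
    dbmsRewards r T R0 x t = dbmsRewards r T R0 y t := by
  induction t with
  | zero => rfl
  | succ t ih =>
    have ih' := ih fun s hs => h s (hs.trans t.lt_succ_self)
    by_cases ht : t ∈ T
    · simp only [dbmsRewards_succ_of_mem ht, ih']
    · simp only [dbmsRewards_succ_of_notMem ht, ih', h t t.lt_succ_self]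

lemma userRewards_congr (h : ∀ s < t, x s = y s) :
    userRewards r T S0 x t = userRewards r T S0 y t := by
  induction t with
  | zero => rfl
  | succ t ih =>
    have ih' := ih fun s hs => h s (hs.trans t.lt_succ_self)
    by_cases ht : t ∈ T
    · simp only [userRewards_succ_of_mem ht, ih', h t t.lt_succ_self]
    · simp only [userRewards_succ_of_notMem ht, ih']

lemma payoffAt_congr {prior : Fin m → ℝ} (h : ∀ s < t, x s = y s) :
    payoffAt prior r T S0 R0 x t = payoffAt prior r T S0 R0 y t := by
  simp only [payoffAt, userStrategy, dbmsStrategy, userRewards_congr h, dbmsRewards_congr h]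

end Round

section IdentityReward

variable {m n : ℕ} {prior : Fin m → ℝ} {T : Set ℕ}
  {S0 : Matrix (Fin m) (Fin n) ℝ} {R0 : Matrix (Fin n) (Fin m) ℝ}

lemma payoff_identityReward_eq_user (U : Matrix (Fin m) (Fin n) ℝ)
    (D : Matrix (Fin n) (Fin m) ℝ) :
    payoff prior (identityReward m) U D = ∑ i, ∑ j, prior i * D j i * U i j := by
  simp only [payoff, identityReward, Matrix.of_apply, mul_ite, mul_one, mul_zero,
    Finset.sum_ite_eq, Finset.mem_univ, if_true, Finset.mul_sum]
  exact Finset.sum_congr rfl fun i _ => Finset.sum_congr rfl fun j _ => by ring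

lemma payoff_identityReward_eq_dbms (U : Matrix (Fin m) (Fin n) ℝ)
    (D : Matrix (Fin n) (Fin m) ℝ) :
    payoff prior (identityReward m) U D = ∑ j, ∑ l, prior l * U l j * D j l := by
  rw [payoff_identityReward_eq_user, Finset.sum_comm]
  exact Finset.sum_congr rfl fun i _ => Finset.sum_congr rfl fun j _ => by ring

lemma abs_payoffAt_le_one (hprior : prior ∈ stdSimplex ℝ (Fin m)) (hS0 : ∀ i j, 0 < S0 i j)
    (hR0 : ∀ j l, 0 < R0 j l) (x : ℕ → Interaction m n m) (t : ℕ) :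
    |payoffAt prior (identityReward m) T S0 R0 x t| ≤ 1 := by
  have hS := userRewards_pos (T := T) (x := x) (t := t) identityReward_nonneg hS0
  have hR := dbmsRewards_pos (T := T) (x := x) (t := t) identityReward_nonneg hR0
  have hU := strategyOf_nonneg hS
  have hD := strategyOf_nonneg hR
  rw [payoffAt, userStrategy, dbmsStrategy, payoff_identityReward_eq_user, abs_of_nonneg
    (Finset.sum_nonneg fun i _ => Finset.sum_nonneg fun j _ =>
      mul_nonneg (mul_nonneg (hprior.1 i) (hD j i)) (hU i j)), ← hprior.2]
  refine Finset.sum_le_sum fun i _ => ?_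
  rcases isEmpty_or_nonempty (Fin n) with hn | ⟨⟨j₀⟩⟩
  · simpa using hprior.1 i
  · calc _ ≤ ∑ j, prior i * strategyOf (userRewards (identityReward m) T S0 x t) i j :=
          Finset.sum_le_sum fun j _ => mul_le_mul_of_nonneg_right
            (mul_le_of_le_one_right (hprior.1 i) (strategyOf_le_one hR j i)) (hU i j)
      _ = prior i := by rw [← Finset.mul_sum, sum_strategyOf hS i j₀, mul_one]

/-- The expected increment of the payoff in round `t`, given the earlier rounds of `x`, is
nonnegative. The payoff after an interaction `a` is that of the sequence `x` with `a` put in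
round `t`. -/
lemma payoff_drift_nonneg (hS0 : ∀ i j, 0 < S0 i j) (hR0 : ∀ j l, 0 < R0 j l)
    (x : ℕ → Interaction m n m) (t : ℕ) :
    0 ≤ ∑ a : Interaction m n m,
      prior a.1 * userStrategy (identityReward m) T S0 x t a.1 a.2.1 *
        dbmsStrategy (identityReward m) T R0 x t a.2.1 a.2.2 *
        (payoffAt prior (identityReward m) T S0 R0 (Function.update x t a) (t + 1) -
          payoffAt prior (identityReward m) T S0 R0 x t) := by
  have hcongr (a : Interaction m n m) : ∀ s < t, Function.update x t a s = x s :=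
    fun s hs => Function.update_of_ne hs.ne _ _
  have hS (a : Interaction m n m) := userRewards_congr (r := identityReward m) (T := T)
    (S0 := S0) (hcongr a)
  have hR (a : Interaction m n m) := dbmsRewards_congr (r := identityReward m) (T := T)
    (R0 := R0) (hcongr a)
  -- Only a correct interpretation changes the payoff.
  have hfail (i l : Fin m) (j : Fin n) (hl : l ≠ i) :
      payoffAt prior (identityReward m) T S0 R0 (Function.update x t (i, j, l)) (t + 1) =
        payoffAt prior (identityReward m) T S0 R0 x t := by
    have hr : identityReward m i l = 0 := by simp [identityReward, hl.symm]
    by_cases ht : t ∈ T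
    · simp [payoffAt, userStrategy, dbmsStrategy, userRewards_succ_of_mem ht,
        dbmsRewards_succ_of_mem ht, hS, hR, hr]
    · simp [payoffAt, userStrategy, dbmsStrategy, userRewards_succ_of_notMem ht,
        dbmsRewards_succ_of_notMem ht, hS, hR, hr]
  have hcollapse (i : Fin m) (j : Fin n) :
      ∑ l, prior i * userStrategy (identityReward m) T S0 x t i j *
        dbmsStrategy (identityReward m) T R0 x t j l *
        (payoffAt prior (identityReward m) T S0 R0 (Function.update x t (i, j, l)) (t + 1) -
          payoffAt prior (identityReward m) T S0 R0 x t) =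
      prior i * userStrategy (identityReward m) T S0 x t i j *
        dbmsStrategy (identityReward m) T R0 x t j i *
        (payoffAt prior (identityReward m) T S0 R0 (Function.update x t (i, j, i)) (t + 1) -
          payoffAt prior (identityReward m) T S0 R0 x t) :=
    Finset.sum_eq_single i (fun l _ hl => by rw [hfail i l j hl, sub_self, mul_zero]) (by simp)
  simp only [Fintype.sum_prod_type, hcollapse]
  by_cases ht : t ∈ T
  · refine (reinforcement_drift_nonneg
      (userRewards_pos (T := T) (x := x) (t := t) identityReward_nonneg hS0)
      fun i j => prior i * dbmsStrategy (identityReward m) T R0 x t j i).trans_eq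
        (Finset.sum_congr rfl fun i _ => Finset.sum_congr rfl fun j _ => ?_)
    simp only [payoffAt, payoff_identityReward_eq_user, userStrategy, dbmsStrategy,
      userRewards_succ_of_mem ht, dbmsRewards_succ_of_mem ht, hS, hR, Function.update_self]
    simp only [identityReward, Matrix.of_apply, if_true]
    ring
  · rw [Finset.sum_comm]
    refine (reinforcement_drift_nonneg
      (dbmsRewards_pos (T := T) (x := x) (t := t) identityReward_nonneg hR0)
      fun j l => prior l * userStrategy (identityReward m) T S0 x t l j).trans_eq
        (Finset.sum_congr rfl fun j _ => Finset.sum_congr rfl fun l _ => ?_)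
    simp only [payoffAt, payoff_identityReward_eq_dbms, userStrategy, dbmsStrategy,
      userRewards_succ_of_notMem ht, dbmsRewards_succ_of_notMem ht, hS, hR, Function.update_self]
    simp only [identityReward, Matrix.of_apply, if_true]

end IdentityReward

/-! ### The filtration of past interactions -/

section Past

variable {Ω : Type*} {m n o : ℕ} {X : ℕ → Ω → Interaction m n o}

/-- The σ-algebras `past X t` as a filtration. -/
def pastFiltration [MeasurableSpace Ω] (hX : ∀ t, Measurable (X t)) :
    Filtration ℕ ‹MeasurableSpace Ω› where
  seq := past X
  mono' _ _ hst := iSup_mono fun _ => iSup_mono' fun h => ⟨h.trans_le hst, le_rfl⟩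
  le' _ := iSup₂_le fun s _ => (hX s).comap_le

/-- A real function of the interactions before round `t` is measurable with respect to the history
because there are only finitely many possible histories. -/
lemma measurable_past_of_congr {t : ℕ} (f : (ℕ → Interaction m n o) → ℝ)
    (hf : ∀ x y, (∀ s < t, x s = y s) → f x = f y) :
    Measurable[past X t] fun ω => f fun s => X s ω := by
  have hdep : DependsOn f (Set.Iio t) := fun x y h => hf x y h
  obtain ⟨g, rfl⟩ := dependsOn_iff_exists_comp.1 hdep
  refine (Measurable.of_discrete (f := g)).comp ?_
  refine @measurable_pi_lambda _ _ _ (past X t) _ _ fun s => ?_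
  exact Measurable.mono (comap_measurable (X s))
    (le_iSup₂_of_le (f := fun (s : ℕ) (_ : s < t) => MeasurableSpace.comap (X s) inferInstance)
      (s : ℕ) s.2 le_rfl) le_rfl

end Past

/-! ### The payoff is a bounded submartingale -/

lemma submartingale_payoffAt {Ω : Type*} [MeasurableSpace Ω] {μ : Measure Ω}
    [IsProbabilityMeasure μ] {m n : ℕ} {prior : Fin m → ℝ} {T : Set ℕ}
    (hprior : prior ∈ stdSimplex ℝ (Fin m))
    {S0 : Matrix (Fin m) (Fin n) ℝ} (hS0 : ∀ i j, 0 < S0 i j)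
    {R0 : Matrix (Fin n) (Fin m) ℝ} (hR0 : ∀ j l, 0 < R0 j l)
    {X : ℕ → Ω → Interaction m n m}
    (hX : IsJointLearning μ prior (identityReward m) T S0 R0 X) :
    Submartingale
      (fun t ω => payoffAt prior (identityReward m) T S0 R0 (fun s => X s ω) t)
      (pastFiltration hX.measurable) μ := by
  set u := fun (t : ℕ) (ω : Ω) =>
    payoffAt prior (identityReward m) T S0 R0 (fun s => X s ω) t with hu
  have hle (t : ℕ) : past X t ≤ ‹MeasurableSpace Ω› := (pastFiltration hX.measurable).le t
  have humeas (t : ℕ) : Measurable[past X t] (u t) :=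
    measurable_past_of_congr
      (fun x => payoffAt prior (identityReward m) T S0 R0 x t)
      fun _ _ h => payoffAt_congr h
  have hint (t : ℕ) : Integrable (u t) μ :=
    .of_bound ((humeas t).mono (hle t) le_rfl).aestronglyMeasurable 1
      (ae_of_all _ fun ω => abs_payoffAt_le_one hprior hS0 hR0 _ t)
  refine submartingale_of_condExp_sub_nonneg_nat (fun t => (humeas t).stronglyMeasurable) hint
    fun t => ?_
  -- The increment that the payoff would have if the interaction of round `t` were `a`.
  let g (a : Interaction m n m) (ω : Ω) : ℝ :=
    payoffAt prior (identityReward m) T S0 R0 (Function.update (fun s => X s ω) t a) (t + 1) -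
      payoffAt prior (identityReward m) T S0 R0 (fun s => X s ω) t
  have hgmeas (a : Interaction m n m) : Measurable[past X t] (g a) :=
    measurable_past_of_congr
      (fun x => payoffAt prior (identityReward m) T S0 R0 (Function.update x t a) (t + 1) -
        payoffAt prior (identityReward m) T S0 R0 x t)
      fun x y h => by
        congr 1
        · refine payoffAt_congr fun s hs => ?_
          rcases eq_or_ne s t with rfl | hst
          · simp
          · simpa [hst] using h s (by omega)
        · exact payoffAt_congr h
  have hgbound (a : Interaction m n m) (ω : Ω) : ‖g a ω‖ ≤ 2 :=
    (norm_sub_le _ _).trans <| (add_le_add (abs_payoffAt_le_one hprior hS0 hR0 _ _)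
      (abs_payoffAt_le_one hprior hS0 hR0 _ _)).trans_eq one_add_one_eq_two
  let A (a : Interaction m n m) : Ω → ℝ := (X t ⁻¹' {a}).indicator fun _ => 1
  have hAint (a : Interaction m n m) : Integrable (A a) μ :=
    (integrable_const 1).indicator (hX.measurable t (measurableSet_singleton a))
  have hgA (a : Interaction m n m) : Integrable (g a * A a) μ :=
    (hAint a).bdd_mul ((hgmeas a).mono (hle t) le_rfl).aestronglyMeasurable
      (ae_of_all _ (hgbound a))
  have hdecomp : u (t + 1) - u t = ∑ a, g a * A a := by
    ext ω
    rw [Finset.sum_apply, Finset.sum_eq_single (X t ω)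
      (fun a _ ha => by simp [A, ha.symm]) (by simp)]
    simp [A, g, hu]
  rw [hdecomp]
  have hpull (a : Interaction m n m) :
      μ[g a * A a | past X t] =ᵐ[μ] g a * μ[A a | past X t] :=
    condExp_mul_of_stronglyMeasurable_left (hgmeas a).stronglyMeasurable (hgA a) (hAint a)
  have hprob (a : Interaction m n m) :
      μ[A a | past X t] =ᵐ[μ] fun ω =>
        prior a.1 * userStrategy (identityReward m) T S0 (fun s => X s ω) t a.1 a.2.1 *
          dbmsStrategy (identityReward m) T R0 (fun s => X s ω) t a.2.1 a.2.2 :=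
    hX.condProb t a.1 a.2.1 a.2.2
  filter_upwards [condExp_finsetSum (s := Finset.univ) (fun a _ => hgA a) (past X t),
    ae_all_iff.2 hpull, ae_all_iff.2 hprob]
    with ω hsum hmul hprob
  refine (payoff_drift_nonneg (prior := prior) (T := T) hS0 hR0 (fun s => X s ω) t).trans_eq
    (Eq.symm (hsum.trans ?_))
  rw [Finset.sum_apply]
  refine Finset.sum_congr rfl fun a _ => ?_
  rw [hmul a, Pi.mul_apply, hprob a, mul_comm]

theorem corollary5p6 {Ω : Type*} [MeasurableSpace Ω] (μ : Measure Ω) [IsProbabilityMeasure μ]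
    {m n : ℕ}
    -- the prior distribution on intents
    (prior : Fin m → ℝ) (hprior : prior ∈ stdSimplex ℝ (Fin m))
    -- the initial reward matrices of the user and of the DBMS
    (S0 : Matrix (Fin m) (Fin n) ℝ) (hS0 : ∀ i j, 0 < S0 i j)
    (R0 : Matrix (Fin n) (Fin m) ℝ) (hR0 : ∀ j l, 0 < R0 j l)
    -- the rounds in which the user adapts
    (τ : ℕ → ℕ) (hτ : StrictMono τ)
    (X : ℕ → Ω → DataInteraction.Interaction m n m)
    (hX : DataInteraction.IsJointLearning μ prior (DataInteraction.identityReward m)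
      (Set.range τ) S0 R0 X) :
    ∀ᵐ ω ∂μ, ∃ c : ℝ, Tendsto
      (fun t => DataInteraction.payoffAt prior (DataInteraction.identityReward m)
        (Set.range τ) S0 R0 (fun s => X s ω) t) atTop (𝓝 c) := by
  refine (submartingale_payoffAt hprior hS0 hR0 hX).exists_ae_tendsto_of_bdd (R := 1) fun t => ?_
  refine (eLpNorm_le_of_ae_bound (C := 1)
    (ae_of_all _ fun ω => abs_payoffAt_le_one hprior hS0 hR0 _ t)).trans ?_
  simp
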